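/- **Setting.** Let $V$ be a finite set of users with $|V|>1$, let $Z_V=(Z_i)_{i\in V}$ be discrete (countably valued) random variables with finite joint entropy, and for $X\subseteq V$ let $H(X)$ be the Shannon entropy of $(Z_i)_{i\in X}$ (to any fixed base $b>1$) and $H(X\mid Y)=H(X\cup Y)-H(Y)$. For $r\in\mathbb R^V$ write $r(X)=\sum_{i\in X}r_i$. Let $$\mathcal R_{CO}(V)=\{r\in\mathbb R^V: r(X)\ge H(X\mid V\setminus X)\ \ \forall X\subsetneq V\},\qquad R_{ACO}(V)=\min\{r(V): r\in\mathcal R_{CO}(V)\},$$ and let $\mathcal R^*_{ACO}(V)=\{r\in \mathcal R_{CO}(V): r(V)=R_{ACO}(V)\}$ be the set of optimal rate vectors. For a nonempty collection $\mathcal P$ of subsets of $V$ with $|\mathcal P|\ne 1$ put $\rho(\mathcal P)=\sum_{X\in\mathcal P}\frac{H(V)-H(X)}{|\mathcal P|-1}$. The *fundamental partition* is the finest maximizer of $\rho$ over all partitions of $V$ other than $\{V\}$ (that is, the maximizer that refines every maximizer). For $\alpha\in\mathbb R$ let $f_\alpha(X)=H(X\mid V\setminus X)$ for $X\subsetneq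 V$, $f_\alpha(V)=\alpha$, and $f^\#_\alpha(X)=f_\alpha(V)-f_\alpha(V\setminus X)$. For a partition $\mathcal P$ let $f^\#_\alpha[\mathcal P]=\sum_{X\in\mathcal P}f^\#_\alpha(X)$, let $\hat f^\#_\alpha(X)=\min\{f^\#_\alpha[\mathcal P]:\mathcal P\text{ a partition of }X\}$ be the Dilworth truncation, and let $B(\hat f^\#_\alpha,\le)=\{r: r(X)\le\hat f^\#_\alpha(X)\ \forall X\subseteq V,\ r(V)=\hat f^\#_\alpha(V)\}$. Fix a linear ordering $\Phi=(\phi_1,\dots,\phi_{|V|})$ of $V$. For a collection $U$ of sets let $\tilde U=\bigcup_{X\in U}X$. *CoordSatCapFus* with input $\alpha$: set $r_i\leftarrow\alpha-H(V)$ for all $i\in V$, then $r_{\phi_1}\leftarrow f^\#_\alpha(\{\phi_1\})$ and $\mathcal P^*\leftarrow\{\{\phi_1\}\}$. For $i=2,\dots,|V|$: let $\hat\xi$ be the minimum of $f^\#_\alpha(\{\phi_i\}\cup\tilde U)-r(\{\phi_i\}\cup\tilde U)$ over $U\subseteq\mathcal P^*$, and $U^*$ its minimal minimizer; put $U^*_{\phi_i}=U^*\cup\{\{\phi_i\}\}$,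 $r_{\phi_i}\leftarrow r_{\phi_i}+\hat\xi$, $\mathcal X=\{X\in\mathcal P^*: X\cap\tilde U^*_{\phi_i}\neq\emptyset\}$ and $\mathcal P^*\leftarrow(\mathcal P^*\setminus\mathcal X)\cup\{\tilde U^*_{\phi_i}\cup\tilde{\mathcal X}\}$. Return $(r,\mathcal P^*)$. *Modified Decomposition Algorithm (MDA)*: set $\mathcal P\leftarrow\{\{i\}:i\in V\}$, $\alpha\leftarrow\rho(\mathcal P)$ and $(r,\mathcal P^*)\leftarrow$ CoordSatCapFus$(\alpha)$. While $\mathcal P^*\ne\mathcal P$: set $\mathcal P\leftarrow\mathcal P^*$, $\alpha\leftarrow\rho(\mathcal P)$ and $(r,\mathcal P^*)\leftarrow$ CoordSatCapFus$(\alpha)$. Return $r$, $\mathcal P^*$ and $\alpha$. **Theorem.** For every such source and every linear ordering $\Phi$ the minimum $R_{ACO}(V)$ is attained, and the MDA stops after finitely many executions of the body of its loop. It returns $\alpha=R_{ACO}(V)$, the partition $\mathcal P^*$ that is the fundamental partition (and $\rho(\mathcal P^*)=R_{ACO}(V)$), and an optimal rate vector $r\in\mathcal R^*_{ACO}(V)$.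 Each call of CoordSatCapFus that the MDA makes, with input $\alpha$ say, returns the finest minimizer of $f^\#_\alpha[\mathcal P]$ over all partitions $\mathcal P$ of $V$ and a rate vector in $B(\hat f^\#_\alpha,\le)$. The successive values of $\alpha$ increase strictly until they reach $R_{ACO}(V)$. -/

import Mathlib

open Finset MeasureTheory

namespace Omniscience

variable {V : Type*} [Fintype V] [DecidableEq V]

/-! ### The source and its entropy function -/

/-- For the discrete random variables `Z i : Ω → S i`, `i ∈ V`, the summand `-p(s) log_b p(s)` of the
Shannon entropy of `(Z i)_{i ∈ X}`, where `p(s)` is the probability that `Z i = s i` for all `i ∈ X`. -/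
noncomputable def entropyTerm {V : Type*} {Ω : Type*} [MeasurableSpace Ω] {S : V → Type*} (b : ℝ)
    (μ : Measure Ω) (Z : ∀ i, Ω → S i) (X : Finset V) (s : ∀ i : X, S i) : ℝ :=
  -(μ.real {ω | ∀ i : X, Z i ω = s i} * Real.logb b (μ.real {ω | ∀ i : X, Z i ω = s i}))

/-- The Shannon entropy `H(X)` of `(Z i)_{i ∈ X}`, with logarithms to the base `b`. -/
noncomputable def entropy {V : Type*} {Ω : Type*} [MeasurableSpace Ω] {S : V → Type*} (b : ℝ)
    (μ : Measure Ω) (Z : ∀ i, Ω → S i) (X : Finset V) : ℝ :=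
  ∑' s : (∀ i : X, S i), entropyTerm b μ Z X s

/-- The conditional entropy `H(X | Y) = H(X ∪ Y) - H(Y)`. -/
def condEntropy (H : Finset V → ℝ) (X Y : Finset V) : ℝ := H (X ∪ Y) - H Y

/-! ### Achievable rates and the minimum sum-rate -/

/-- The rate vectors that satisfy the Slepian-Wolf constraints `r(X) ≥ H(X | V \ X)`, `X ⊂ V`. -/
def achievableRates (H : Finset V → ℝ) : Set (V → ℝ) :=
  {r | ∀ X : Finset V, X ⊂ univ → condEntropy H X (univ \ X) ≤ ∑ i ∈ X, r i}

/-- The sum-rates `r(V)` of the achievable rate vectors. -/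
def achievableSumRates (H : Finset V → ℝ) : Set ℝ :=
  (fun r : V → ℝ => ∑ i, r i) '' achievableRates H

/-- The minimum asymptotic sum-rate `R_ACO(V)`. -/
noncomputable def RACO (H : Finset V → ℝ) : ℝ := sInf (achievableSumRates H)

/-- The achievable rate vectors whose sum-rate is `R_ACO(V)`. -/
def optimalRates (H : Finset V → ℝ) : Set (V → ℝ) :=
  {r | r ∈ achievableRates H ∧ ∑ i, r i = RACO H}

/-! ### The set functions `f_α` and `f_α^#`, base polyhedra, Dilworth truncation -/

/-- `f_α(X) = H(X | V \ X)` for `X ⊂ V`, and `f_α(V) = α`. -/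
def fFun (H : Finset V → ℝ) (α : ℝ) (X : Finset V) : ℝ :=
  if X = univ then α else condEntropy H X (univ \ X)

/-- The dual set function `f_α^#(X) = f_α(V) - f_α(V \ X)`. -/
def fDual (H : Finset V → ℝ) (α : ℝ) (X : Finset V) : ℝ :=
  fFun H α univ - fFun H α (univ \ X)

/-- The base polyhedron `B(g, ≤) = {r | r(X) ≤ g(X) for all X ⊆ V, and r(V) = g(V)}`. -/
def basePolyhedron (g : Finset V → ℝ) : Set (V → ℝ) :=
  {r | (∀ X : Finset V, ∑ i ∈ X, r i ≤ g X) ∧ ∑ i, r i = g univ}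

/-- `g[P] = ∑_{X ∈ P} g(X)`. -/
def partSum (g : Finset V → ℝ) {A : Finset V} (P : Finpartition A) : ℝ := ∑ X ∈ P.parts, g X

/-- The Dilworth truncation `X ↦ min_P g[P]`, the minimum over the (finitely many) partitions `P`
of `X`. -/
noncomputable def dilworthTruncation (g : Finset V → ℝ) (X : Finset V) : ℝ :=
  ⨅ P : Finpartition X, partSum g P

/-- `P` is the finest minimizer of `g[P]` over all partitions of `V`. In the order of `Finpartition`,
`P ≤ Q` says that `P` is finer than or equal to `Q`. -/
def IsFinestMinimizer (g : Finset V → ℝ) (P : Finpartition (univ : Finset V)) : Prop :=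
  IsLeast {P : Finpartition (univ : Finset V) |
    ∀ Q : Finpartition (univ : Finset V), partSum g P ≤ partSum g Q} P

/-! ### The fundamental partition -/

/-- `∑_{X ∈ P} (H(V) - H(X)) / (|P| - 1)`. -/
noncomputable def partitionRate (H : Finset V → ℝ) (P : Finset (Finset V)) : ℝ :=
  ∑ X ∈ P, (H univ - H X) / ((P.card : ℝ) - 1)

/-- `P` maximizes `partitionRate` over all partitions of `V` other than `{V}`. -/
def IsRateMaximizer (H : Finset V → ℝ) (P : Finpartition (univ : Finset V)) : Prop :=
  P.parts ≠ {univ} ∧ ∀ Q : Finpartition (univ : Finset V), Q.parts ≠ {univ} →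
    partitionRate H Q.parts ≤ partitionRate H P.parts

/-- `P` is the fundamental partition: the finest maximizer of `partitionRate`. -/
def IsFundamentalPartition (H : Finset V → ℝ) (P : Finpartition (univ : Finset V)) : Prop :=
  IsLeast {P | IsRateMaximizer H P} P

/-! ### The algorithm CoordSatCapFus -/

/-- The union `Ũ` of the sets in `U`. -/
def fuse (U : Finset (Finset V)) : Finset V := U.biUnion id

/-- `U` is an inclusion-minimal element among the minimizers of `g` over the subsets of `P`. -/
def IsMinimalMinimizer (g : Finset (Finset V) → ℝ) (P U : Finset (Finset V)) : Prop :=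
  Minimal (fun U => U ⊆ P ∧ ∀ W ⊆ P, g U ≤ g W) U

theorem exists_isMinimalMinimizer {V : Type*} [Finite V] (g : Finset (Finset V) → ℝ) (P : Finset (Finset V)) :
    ∃ U, IsMinimalMinimizer g P U := by
  obtain ⟨U, hU, hmin⟩ := P.powerset.exists_min_image g ⟨∅, by simp⟩
  obtain ⟨W, -, hW⟩ := (Set.toFinite {U | U ⊆ P ∧ ∀ W ⊆ P, g U ≤ g W}).exists_le_minimal
    (a := U) ⟨by simpa using hU, fun W hW => hmin W (by simpa using hW)⟩
  exact ⟨W, hW⟩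

/-- The minimal minimizer of `g` over the subsets of `P`. -/
noncomputable def minimalMinimizer (g : Finset (Finset V) → ℝ) (P : Finset (Finset V)) :
    Finset (Finset V) :=
  (exists_isMinimalMinimizer g P).choose

/-- The objective `f_α^#({φ} ∪ Ũ) - r({φ} ∪ Ũ)` of the saturation capacity problem. -/
def satObjective (H : Finset V → ℝ) (α : ℝ) (r : V → ℝ) (φ : V) (U : Finset (Finset V)) : ℝ :=
  fDual H α ({φ} ∪ fuse U) - ∑ i ∈ {φ} ∪ fuse U, r i

/-- One pass of the for-loop, for the user `φ`, on the pair of the current rate vector `r` and the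
current partition `P` of the users that were treated before: raise `r φ` by the saturation
capacity (the minimum, attained at `U`), and merge. -/
noncomputable def satStep (H : Finset V → ℝ) (α : ℝ) (s : (V → ℝ) × Finset (Finset V)) (φ : V) :
    (V → ℝ) × Finset (Finset V) :=
  let r := s.1
  let P := s.2
  let U := minimalMinimizer (satObjective H α r φ) P
  let ξ := satObjective H α r φ U
  let Uφ := U ∪ {{φ}}
  let 𝒳 := P.filter fun X => (X ∩ fuse Uφ).Nonempty
  (Function.update r φ (r φ + ξ), (P \ 𝒳) ∪ {fuse Uφ ∪ fuse 𝒳})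

/-- CoordSatCapFus with the users in the order of the list: the returned pair is the rate vector
and the partition. -/
noncomputable def coordSatCapFus (H : Finset V → ℝ) (α : ℝ) :
    List V → (V → ℝ) × Finset (Finset V)
  | [] => (fun _ => α - H univ, ∅)
  | φ₁ :: φs =>
    φs.foldl (satStep H α)
      (Function.update (fun _ => α - H univ) φ₁ (fDual H α {φ₁}), {{φ₁}})

/-! ### The Modified Decomposition Algorithm -/

/-- The variables of the Modified Decomposition Algorithm: the partition `P`, the estimate `α`, and
the last result `(r, Pstar)` of CoordSatCapFus. -/
structure MDAState (V : Type*) where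
  P : Finset (Finset V)
  α : ℝ
  r : V → ℝ
  Pstar : Finset (Finset V)

/-- Set the partition to `P` and the estimate to `partitionRate H P`, and call CoordSatCapFus. -/
noncomputable def mdaUpdate (H : Finset V → ℝ) (Φ : Fin (Fintype.card V) ≃ V)
    (P : Finset (Finset V)) : MDAState V where
  P := P
  α := partitionRate H P
  r := (coordSatCapFus H (partitionRate H P) (List.ofFn Φ)).1
  Pstar := (coordSatCapFus H (partitionRate H P) (List.ofFn Φ)).2

/-- The variables after `n` executions of the body of the while-loop. The algorithm starts from the
partition into singletons. -/
noncomputable def mdaState (H : Finset V → ℝ) (Φ : Fin (Fintype.card V) ≃ V) : ℕ → MDAState V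
  | 0 => mdaUpdate H Φ (univ.image fun i : V => {i})
  | n + 1 => mdaUpdate H Φ (mdaState H Φ n).Pstar

/-- The while-loop (`while Pstar ≠ P`) stops after exactly `N` executions of its body; the algorithm
then returns `r`, `Pstar` and `α` of `mdaState H Φ N`. -/
def MDAStopsAfter (H : Finset V → ℝ) (Φ : Fin (Fintype.card V) ≃ V) (N : ℕ) : Prop :=
  (∀ n < N, (mdaState H Φ n).Pstar ≠ (mdaState H Φ n).P) ∧
    (mdaState H Φ N).Pstar = (mdaState H Φ N).P

end Omniscience

/-! The entropy enters only through its submodularity; the rest works for any submodular `H`.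

For a partition `P ≠ {V}` one has `f^#_α[P] = α + (|P| - 1)(α - ρ(P))`, while `{V}` has value `α`
(`partSum_fDual_of_ne`, `partSum_fDual_of_eq`). So at `α = ρ(P)` the partition `P` itself has value
`α`, and a partition has smaller value exactly when it is nontrivial with `ρ > α`. Hence a call of
CoordSatCapFus either certifies `P` as a minimizer or yields a partition with larger `ρ`.

CoordSatCapFus is analysed by the invariant `IsSaturated`: `r` obeys the constraints of `f^#_α` on
the users treated so far, and the current blocks form the finest partition into tight sets
(`IsSaturated.satStep`). On all of `V`, `r(V) ≤ f^#_α[Q]` for every partition `Q`, with equality iff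
all blocks of `Q` are tight; so the output is the finest minimizer
(`IsSaturated.isFinestMinimizer`).

The stopping test compares partitions, not values. It is sound because finest minimizers coarsen as
`α` grows (`IsSaturated.le_of_lt`), so the current partition always refines the next one. At the
stop `r(V) = α = ρ(P)`, and `ρ(P)` bounds every achievable sum-rate from below
(`partitionRate_le_of_mem_achievableRates`), so both sides are optimal. -/

namespace Omniscience

/-! ### Submodularity of Shannon entropy for countably valued variables. -/

section Entropy

variable {V : Type*} {Ω : Type*} [MeasurableSpace Ω] {S : V → Type*}

/-- The joint distribution of `(Z i)_{i ∈ X}`. -/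
noncomputable def jointLaw [∀ i, MeasurableSpace (S i)] (μ : Measure Ω) (Z : ∀ i, Ω → S i)
    (X : Finset V) : Measure (∀ i : X, S i) :=
  μ.map fun ω i => Z i ω

/-- The logarithm of the probability of the observed value of `(Z i)_{i ∈ X}`. -/
noncomputable def logProb (μ : Measure Ω) (Z : ∀ i, Ω → S i) (X : Finset V) (ω : Ω) : ℝ :=
  Real.log (μ.real {ω' | ∀ i : X, Z i ω' = Z i ω})

variable {μ : Measure Ω} {Z : ∀ i, Ω → S i}

theorem jointProb_anti [IsProbabilityMeasure μ] {X Y : Finset V} (h : X ⊆ Y) (ω : Ω) :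
    μ.real {ω' | ∀ i : Y, Z i ω' = Z i ω} ≤ μ.real {ω' | ∀ i : X, Z i ω' = Z i ω} :=
  measureReal_mono fun _ hω i => hω ⟨i, h i.2⟩

variable [∀ i, MeasurableSpace (S i)]

theorem measurable_joint (hZ : ∀ i, Measurable (Z i)) (X : Finset V) :
    Measurable fun ω (i : X) => Z i ω :=
  measurable_pi_lambda _ fun i => hZ i

theorem isProbabilityMeasure_jointLaw [IsProbabilityMeasure μ] (hZ : ∀ i, Measurable (Z i))
    (X : Finset V) : IsProbabilityMeasure (jointLaw μ Z X) :=
  Measure.isProbabilityMeasure_map (measurable_joint hZ X).aemeasurable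

variable [∀ i, MeasurableSingletonClass (S i)]

theorem jointLaw_singleton (hZ : ∀ i, Measurable (Z i)) (X : Finset V) (s : ∀ i : X, S i) :
    jointLaw μ Z X {s} = μ {ω | ∀ i : X, Z i ω = s i} := by
  rw [jointLaw, Measure.map_apply (measurable_joint hZ X) (measurableSet_singleton s)]
  congr 1
  ext ω
  simp [funext_iff]

theorem jointLaw_real_singleton (hZ : ∀ i, Measurable (Z i)) (X : Finset V) (s : ∀ i : X, S i) :
    (jointLaw μ Z X).real {s} = μ.real {ω | ∀ i : X, Z i ω = s i} := by
  rw [measureReal_def, jointLaw_singleton hZ, measureReal_def]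

variable [∀ i, Countable (S i)]

theorem jointLaw_fiber (hZ : ∀ i, Measurable (Z i)) {X Y : Finset V} (h : X ⊆ Y)
    (s : ∀ i : X, S i) :
    jointLaw μ Z Y {y | restrict₂ h y = s} = jointLaw μ Z X {s} := by
  rw [jointLaw_singleton hZ, jointLaw,
    Measure.map_apply (measurable_joint hZ Y) (Set.to_countable _).measurableSet]
  congr 1
  ext ω
  simp [funext_iff, restrict₂]

/-- The values of probability zero are countably many, so together they form a null set. This keeps
the convention `log 0 = 0` out of the estimates below. -/
theorem ae_jointProb_pos [IsProbabilityMeasure μ] (hZ : ∀ i, Measurable (Z i)) (X : Finset V) :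
    ∀ᵐ ω ∂μ, 0 < μ.real {ω' | ∀ i : X, Z i ω' = Z i ω} := by
  have h : ∀ᵐ s ∂jointLaw μ Z X, 0 < μ.real {ω | ∀ i : X, Z i ω = s i} := by
    rw [ae_iff_of_countable]
    intro s hs
    rw [jointLaw_singleton hZ] at hs
    exact ENNReal.toReal_pos hs (measure_ne_top _ _)
  exact ae_of_ae_map (measurable_joint hZ X).aemeasurable h

theorem measurable_of_joint (hZ : ∀ i, Measurable (Z i)) (X : Finset V) {β : Type*}
    [MeasurableSpace β] (F : (∀ i : X, S i) → β) : Measurable fun ω => F fun i => Z i ω :=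
  (Measurable.of_discrete (f := F)).comp (measurable_joint hZ X)

theorem measurable_jointProb (hZ : ∀ i, Measurable (Z i)) (X : Finset V) :
    Measurable fun ω => μ.real {ω' | ∀ i : X, Z i ω' = Z i ω} :=
  measurable_of_joint hZ X fun s => μ.real {ω' | ∀ i : X, Z i ω' = s i}

theorem measurable_logProb (hZ : ∀ i, Measurable (Z i)) (X : Finset V) :
    Measurable (logProb μ Z X) :=
  Real.measurable_log.comp (measurable_jointProb hZ X)

theorem integrable_logProb_of_summable [IsProbabilityMeasure μ] (hZ : ∀ i, Measurable (Z i))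
    {b : ℝ} (hb : 1 < b) {X : Finset V} (hfin : Summable (entropyTerm b μ Z X)) :
    Integrable (logProb μ Z X) μ := by
  have := isProbabilityMeasure_jointLaw (μ := μ) hZ X
  have hlog := Real.log_pos hb
  have hs : Summable fun s : ∀ i : X, S i =>
      Real.log (μ.real {ω | ∀ i : X, Z i ω = s i}) * μ.real {ω | ∀ i : X, Z i ω = s i} := by
    refine (hfin.mul_left (-Real.log b)).congr fun s => ?_
    simp only [entropyTerm, Real.logb]
    field_simp
  have hi : Integrable (fun s : ∀ i : X, S i => Real.log (μ.real {ω | ∀ i : X, Z i ω = s i}))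
      (jointLaw μ Z X) := by
    refine ⟨Measurable.of_discrete.aestronglyMeasurable, ?_⟩
    rw [hasFiniteIntegral_iff_enorm, lintegral_countable']
    refine lt_of_eq_of_lt (tsum_congr fun s => ?_) hs.abs.tsum_ofReal_lt_top
    rw [abs_mul, ENNReal.ofReal_mul (abs_nonneg _), jointLaw_singleton hZ,
      Real.enorm_eq_ofReal_abs, abs_of_nonneg measureReal_nonneg,
      ofReal_measureReal (measure_ne_top _ _)]
  exact (integrable_map_measure hi.aestronglyMeasurable
    (measurable_joint hZ X).aemeasurable).1 hi

/-- Since `p_Y ≤ p_X ≤ 1`, almost surely `|log p_X| ≤ |log p_Y|`. Finite joint entropy thus passes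
to all subfamilies. -/
theorem integrable_logProb_mono [IsProbabilityMeasure μ] (hZ : ∀ i, Measurable (Z i))
    {X Y : Finset V} (h : X ⊆ Y) (hY : Integrable (logProb μ Z Y) μ) :
    Integrable (logProb μ Z X) μ := by
  refine hY.mono (measurable_logProb hZ X).aestronglyMeasurable ?_
  filter_upwards [ae_jointProb_pos hZ Y] with ω hω
  have hle := jointProb_anti (μ := μ) (Z := Z) h ω
  have h1 : ∀ W : Finset V, logProb μ Z W ω ≤ 0 := fun W =>
    Real.log_nonpos measureReal_nonneg measureReal_le_one
  rw [Real.norm_of_nonpos (h1 X), Real.norm_of_nonpos (h1 Y), neg_le_neg_iff]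
  exact Real.log_le_log hω hle

theorem entropy_eq_integral [IsProbabilityMeasure μ] (hZ : ∀ i, Measurable (Z i)) (b : ℝ)
    {X : Finset V} (hX : Integrable (logProb μ Z X) μ) :
    entropy b μ Z X = -(∫ ω, logProb μ Z X ω ∂μ) / Real.log b := by
  have hm : AEStronglyMeasurable (fun s : ∀ i : X, S i =>
      Real.log (μ.real {ω | ∀ i : X, Z i ω = s i})) (jointLaw μ Z X) :=
    Measurable.of_discrete.aestronglyMeasurable
  have h1 : ∫ ω, logProb μ Z X ω ∂μ = ∫ s : (∀ i : X, S i),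
      Real.log (μ.real {ω | ∀ i : X, Z i ω = s i}) ∂jointLaw μ Z X :=
    (integral_map (measurable_joint hZ X).aemeasurable hm).symm
  have hi : Integrable _ (jointLaw μ Z X) :=
    (integrable_map_measure hm (measurable_joint hZ X).aemeasurable).2 hX
  rw [h1, integral_countable hi, entropy, ← tsum_neg, ← tsum_div_const]
  refine tsum_congr fun s => ?_
  rw [entropyTerm, jointLaw_real_singleton hZ, Real.logb, smul_eq_mul]
  ring

/-- The expected value of `p_X p_Y / (p_{X ∪ Y} p_{X ∩ Y})` is at most one. -/
theorem lintegral_probRatio_le_one [DecidableEq V] [IsProbabilityMeasure μ]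
    (hZ : ∀ i, Measurable (Z i)) (X Y : Finset V) :
    ∫⁻ ω, μ {ω' | ∀ i : X, Z i ω' = Z i ω} * μ {ω' | ∀ i : Y, Z i ω' = Z i ω} /
      (μ {ω' | ∀ i : ↥(X ∪ Y), Z i ω' = Z i ω} * μ {ω' | ∀ i : ↥(X ∩ Y), Z i ω' = Z i ω}) ∂μ ≤ 1 := by
  classical
  set P : ∀ W : Finset V, (∀ i : W, S i) → ENNReal := fun W s => jointLaw μ Z W {s} with hP
  have hPt : ∀ W s, P W s ≠ ⊤ := fun W s => by
    have := isProbabilityMeasure_jointLaw (μ := μ) hZ W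
    exact measure_ne_top _ _
  have hXU : X ⊆ X ∪ Y := subset_union_left
  have hYU : Y ⊆ X ∪ Y := subset_union_right
  have hIX : X ∩ Y ⊆ X := inter_subset_left
  have hIY : X ∩ Y ⊆ Y := inter_subset_right
  let F : (∀ i : ↥(X ∪ Y), S i) → ENNReal := fun u =>
    P X (restrict₂ hXU u) * P Y (restrict₂ hYU u) /
      (P (X ∪ Y) u * P (X ∩ Y) (restrict₂ (hIX.trans hXU) u))
  -- The weight `p_X(x) p_Y(y) / p_{X ∩ Y}`, restricted to pairs that agree on `X ∩ Y`: the
  -- conditionally independent coupling of the two marginals.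
  let G : (∀ i : X, S i) × (∀ i : Y, S i) → ENNReal := fun q =>
    P X q.1 / P (X ∩ Y) (restrict₂ hIX q.1) *
      (if restrict₂ hIY q.2 = restrict₂ hIX q.1 then P Y q.2 else 0)
  have hinj : Function.Injective fun u : (∀ i : ↥(X ∪ Y), S i) =>
      ((restrict₂ hXU u, restrict₂ hYU u) : (∀ i : X, S i) × (∀ i : Y, S i)) := by
    intro u v huv
    simp only [Prod.mk.injEq] at huv
    ext ⟨i, hi⟩
    rcases mem_union.1 hi with h | h
    · exact congrFun huv.1 ⟨i, h⟩
    · exact congrFun huv.2 ⟨i, h⟩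
  calc _ = ∫⁻ ω, F (fun i => Z i ω) ∂μ := by
        refine lintegral_congr fun ω => ?_
        simp only [F, hP, jointLaw_singleton hZ]
        rfl
    _ = ∫⁻ u, F u ∂jointLaw μ Z (X ∪ Y) :=
        (lintegral_map Measurable.of_discrete (measurable_joint hZ _)).symm
    _ = ∑' u, F u * P (X ∪ Y) u := lintegral_countable' _
    -- Only an inequality: values `u` of probability zero contribute nothing on the left.
    _ ≤ ∑' u : (∀ i : ↥(X ∪ Y), S i), G (restrict₂ hXU u, restrict₂ hYU u) := by
        refine ENNReal.tsum_le_tsum fun u => ?_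
        have : restrict₂ hIY (restrict₂ hYU u) = restrict₂ hIX (restrict₂ hXU u) := rfl
        simp only [F, G, this, if_true]
        by_cases h0 : P (X ∪ Y) u = 0
        · simp [h0]
        · rw [ENNReal.div_eq_inv_mul, ENNReal.mul_inv (Or.inl h0) (Or.inl (hPt _ _)),
            ENNReal.div_eq_inv_mul]
          have h1 := ENNReal.inv_mul_cancel h0 (hPt _ _)
          calc _ = ((P (X ∪ Y) u)⁻¹ * P (X ∪ Y) u) *
                ((P (X ∩ Y) (restrict₂ (hIX.trans hXU) u))⁻¹ * P X (restrict₂ hXU u) *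
                  P Y (restrict₂ hYU u)) := by ring
            _ ≤ _ := by rw [h1, one_mul]; rfl
    _ ≤ ∑' q, G q := ENNReal.tsum_comp_le_tsum_of_injective hinj G
    _ = ∑' x : (∀ i : X, S i), P X x / P (X ∩ Y) (restrict₂ hIX x) *
          P (X ∩ Y) (restrict₂ hIX x) := by
        rw [ENNReal.tsum_prod']
        refine tsum_congr fun x => ?_
        simp only [G]
        rw [ENNReal.tsum_mul_left]
        congr 1
        simp only [hP]
        rw [← jointLaw_fiber hZ hIY, ← lintegral_indicator_one (Set.to_countable _).measurableSet,
          lintegral_countable']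
        refine tsum_congr fun y => ?_
        by_cases hy : restrict₂ hIY y = restrict₂ hIX x <;> simp [Set.indicator, hy]
    _ ≤ ∑' x : (∀ i : X, S i), P X x :=
        ENNReal.tsum_le_tsum fun x => ENNReal.mul_le_of_le_div le_rfl
    _ = 1 := by
        have := isProbabilityMeasure_jointLaw (μ := μ) hZ X
        rw [← measure_univ (μ := jointLaw μ Z X), ← lintegral_one, lintegral_countable']
        simp [hP]

/-- The Shannon entropy function is submodular. -/
theorem entropy_submodular [Fintype V] [DecidableEq V] [IsProbabilityMeasure μ]
    (hZ : ∀ i, Measurable (Z i)) {b : ℝ} (hb : 1 < b)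
    (hfin : Summable (entropyTerm b μ Z (univ : Finset V))) (X Y : Finset V) :
    entropy b μ Z (X ∪ Y) + entropy b μ Z (X ∩ Y) ≤ entropy b μ Z X + entropy b μ Z Y := by
  have hi : ∀ W : Finset V, Integrable (logProb μ Z W) μ := fun W =>
    integrable_logProb_mono hZ (subset_univ W) (integrable_logProb_of_summable hZ hb hfin)
  let p : Finset V → Ω → ℝ := fun W ω => μ.real {ω' | ∀ i : W, Z i ω' = Z i ω}
  let R : Ω → ℝ := fun ω => p X ω * p Y ω / (p (X ∪ Y) ω * p (X ∩ Y) ω)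
  have hpos : ∀ᵐ ω ∂μ, ∀ W : Finset V, 0 < p W ω :=
    ae_all_iff.2 fun W => ae_jointProb_pos hZ W
  have hR0 : ∀ ω, 0 ≤ R ω := fun ω => by
    simp only [R, p]
    positivity
  have hRm : Measurable R :=
    ((measurable_jointProb hZ X).mul (measurable_jointProb hZ Y)).div
      ((measurable_jointProb hZ _).mul (measurable_jointProb hZ _))
  have hRl : ∫⁻ ω, ENNReal.ofReal (R ω) ∂μ ≤ 1 := by
    refine le_of_eq_of_le (lintegral_congr_ae ?_) (lintegral_probRatio_le_one hZ X Y)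
    filter_upwards [hpos] with ω hω
    rw [ENNReal.ofReal_div_of_pos (mul_pos (hω _) (hω _)), ENNReal.ofReal_mul (hω _).le,
      ENNReal.ofReal_mul (hω _).le]
    have h : ∀ W, ENNReal.ofReal (p W ω) = μ {ω' | ∀ i : W, Z i ω' = Z i ω} := fun W =>
      ofReal_measureReal (measure_ne_top _ _)
    rw [h, h, h, h]
  have hRi : Integrable R μ := by
    refine ⟨hRm.aestronglyMeasurable, ?_⟩
    rw [hasFiniteIntegral_iff_ofReal (ae_of_all _ hR0)]
    exact hRl.trans_lt ENNReal.one_lt_top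
  have hR1 : ∫ ω, R ω ∂μ ≤ 1 := by
    rw [integral_eq_lintegral_of_nonneg_ae (ae_of_all _ hR0) hRm.aestronglyMeasurable]
    exact ENNReal.toReal_le_of_le_ofReal zero_le_one (by simpa using hRl)
  -- This is `log R ≤ R - 1` integrated; the left side is nonnegative because `R` has mean at most
  -- one.
  have key : ∫ ω, (1 - R ω) ∂μ ≤ ∫ ω, ((logProb μ Z (X ∪ Y) ω + logProb μ Z (X ∩ Y) ω) -
      (logProb μ Z X ω + logProb μ Z Y ω)) ∂μ := by
    refine integral_mono_ae ((integrable_const 1).sub hRi)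
      (((hi _).add (hi _)).sub ((hi _).add (hi _))) ?_
    filter_upwards [hpos] with ω hω
    have hRpos : 0 < R ω := div_pos (mul_pos (hω _) (hω _)) (mul_pos (hω _) (hω _))
    have h1 := Real.log_le_sub_one_of_pos hRpos
    have h2 : Real.log (R ω) = logProb μ Z X ω + logProb μ Z Y ω -
        (logProb μ Z (X ∪ Y) ω + logProb μ Z (X ∩ Y) ω) := by
      simp only [R]
      rw [Real.log_div (mul_pos (hω _) (hω _)).ne' (mul_pos (hω _) (hω _)).ne',
        Real.log_mul (hω _).ne' (hω _).ne', Real.log_mul (hω _).ne' (hω _).ne']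
      rfl
    linarith
  have hadd : ∀ W W' : Finset V, ∫ ω, (logProb μ Z W ω + logProb μ Z W' ω) ∂μ =
      ∫ ω, logProb μ Z W ω ∂μ + ∫ ω, logProb μ Z W' ω ∂μ := fun W W' =>
    integral_add (hi W) (hi W')
  rw [integral_sub (integrable_const 1) hRi,
    integral_sub (f := fun ω => logProb μ Z (X ∪ Y) ω + logProb μ Z (X ∩ Y) ω)
      (g := fun ω => logProb μ Z X ω + logProb μ Z Y ω)
      ((hi _).add (hi _)) ((hi _).add (hi _)), hadd, hadd] at key
  simp only [integral_const, probReal_univ, smul_eq_mul, mul_one] at key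
  rw [entropy_eq_integral hZ b (hi _), entropy_eq_integral hZ b (hi _),
    entropy_eq_integral hZ b (hi _), entropy_eq_integral hZ b (hi _), ← add_div, ← add_div]
  exact div_le_div_of_nonneg_right (by linarith) (Real.log_pos hb).le

end Entropy

/-! ### Tight sets and their finest partition. -/

section Saturation

variable {V : Type*} [DecidableEq V]

/-- Submodularity on pairs of intersecting sets. -/
def IntersectingSubmodular (g : Finset V → ℝ) : Prop :=
  ∀ X Y : Finset V, (X ∩ Y).Nonempty → g (X ∪ Y) + g (X ∩ Y) ≤ g X + g Y

theorem mem_fuse {U : Finset (Finset V)} {v : V} : v ∈ fuse U ↔ ∃ X ∈ U, v ∈ X := by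
  simp [fuse]

theorem fuse_insert (X : Finset V) (U : Finset (Finset V)) : fuse (insert X U) = X ∪ fuse U := by
  simp [fuse]

theorem fuse_union (U W : Finset (Finset V)) : fuse (U ∪ W) = fuse U ∪ fuse W := by
  ext v; simp [mem_fuse, or_and_right, exists_or]

theorem fuse_inter {P U W : Finset (Finset V)} (hP : (P : Set (Finset V)).PairwiseDisjoint id)
    (hU : U ⊆ P) (hW : W ⊆ P) : fuse (U ∩ W) = fuse U ∩ fuse W := by
  ext v
  simp only [mem_fuse, mem_inter]
  constructor
  · rintro ⟨X, ⟨hXU, hXW⟩, hv⟩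
    exact ⟨⟨X, hXU, hv⟩, X, hXW, hv⟩
  · rintro ⟨⟨X, hXU, hv⟩, Y, hYW, hv'⟩
    have : X = Y := hP.elim_finset (hU hXU) (hW hYW) v hv hv'
    subst this
    exact ⟨X, ⟨hXU, hYW⟩, hv⟩

/-- `P` is the finest partition of `A` into tight sets of the vector `r`, which satisfies the
constraints of `g` on `A`. Being finest is expressed by colourings: if every point of `A` lies in a
monochromatic tight subset of `A`, then the blocks of `P` are monochromatic. -/
structure IsSaturated (g : Finset V → ℝ) (A : Finset V) (r : V → ℝ) (P : Finset (Finset V)) :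
    Prop where
  nonempty : ∀ B ∈ P, B.Nonempty
  disjoint : (P : Set (Finset V)).PairwiseDisjoint id
  fuse_eq : fuse P = A
  le : ∀ X ⊆ A, X.Nonempty → ∑ i ∈ X, r i ≤ g X
  tight : ∀ B ∈ P, ∑ i ∈ B, r i = g B
  finest : ∀ c : V → Finset V,
    (∀ v ∈ A, ∃ W ⊆ A, v ∈ W ∧ ∑ i ∈ W, r i = g W ∧ ∀ w ∈ W, c w = c v) →
      ∀ B ∈ P, ∀ v ∈ B, ∀ w ∈ B, c v = c w

theorem isSaturated_singleton {g : Finset V → ℝ} {v : V} {r : V → ℝ} (h : r v = g {v}) :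
    IsSaturated g {v} r {{v}} where
  nonempty := by simp
  disjoint := by simp
  fuse_eq := by simp [fuse]
  le := by
    intro X hX hne
    rw [(subset_singleton_iff.1 hX).resolve_left hne.ne_empty]
    simp [h]
  tight := by simp [h]
  finest := by
    intro c _ B hB v hv w hw
    simp only [mem_singleton] at hB
    subst hB
    rw [mem_singleton.1 hv, mem_singleton.1 hw]

namespace IsSaturated

variable {g : Finset V → ℝ} {A : Finset V} {r : V → ℝ} {P : Finset (Finset V)}

theorem block_subset (h : IsSaturated g A r P) {B : Finset V} (hB : B ∈ P) : B ⊆ A := fun _ hv =>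
  h.fuse_eq ▸ mem_fuse.2 ⟨B, hB, hv⟩

/-- Joining blocks to a set that meets them does not increase the slack `g - r`. -/
theorem slack_union_fuse_le (h : IsSaturated g A r P) (hg : IntersectingSubmodular g)
    (X : Finset V) {T : Finset (Finset V)} (hT : T ⊆ P) (hX : ∀ B ∈ T, (X ∩ B).Nonempty) :
    g (X ∪ fuse T) - ∑ i ∈ X ∪ fuse T, r i ≤ g X - ∑ i ∈ X, r i := by
  induction T using Finset.induction_on with
  | empty => simp [fuse]
  | insert B T _ ih =>
    have ih := ih ((subset_insert _ _).trans hT) fun C hC => hX C (mem_insert_of_mem hC)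
    have hB := hT (mem_insert_self B T)
    have hne : ((X ∪ fuse T) ∩ B).Nonempty :=
      (hX B (mem_insert_self B T)).mono (inter_subset_inter_right subset_union_left)
    have h1 := hg _ _ hne
    have h2 := h.le _ (inter_subset_right.trans (h.block_subset hB)) hne
    have h3 := sum_union_inter (s₁ := X ∪ fuse T) (s₂ := B) (f := r)
    have h4 := h.tight B hB
    rw [fuse_insert, union_comm B, ← union_assoc]
    linarith

/-- Together with `slack_union_fuse_le` this shows that the minimum over unions of blocks is as
small as the minimum over all sets containing `φ`. -/
theorem subset_union_fuse_filter (h : IsSaturated g A r P) {φ : V} {X : Finset V}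
    (hX : X ⊆ insert φ A) (hφ : φ ∈ X) :
    X ∪ fuse (P.filter fun B => (X ∩ B).Nonempty) =
      {φ} ∪ fuse (P.filter fun B => (X ∩ B).Nonempty) := by
  ext v
  simp only [mem_union, mem_singleton]
  constructor
  · rintro (hv | hv)
    · rcases mem_insert.1 (hX hv) with hv' | hv'
      · exact Or.inl hv'
      · rw [← h.fuse_eq] at hv'
        obtain ⟨B, hB, hvB⟩ := mem_fuse.1 hv'
        exact Or.inr (mem_fuse.2 ⟨B, mem_filter.2 ⟨hB, v, mem_inter.2 ⟨hv, hvB⟩⟩, hvB⟩)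
    · exact Or.inr hv
  · rintro (rfl | hv)
    · exact Or.inl hφ
    · exact Or.inr hv

end IsSaturated

theorem sum_eq_sum_parts {A : Finset V} (Q : Finpartition A) (r : V → ℝ) :
    ∑ i ∈ A, r i = ∑ B ∈ Q.parts, ∑ i ∈ B, r i := by
  conv_lhs => rw [← Q.biUnion_parts]
  exact sum_biUnion Q.disjoint

end Saturation

/-! ### Correctness of CoordSatCapFus. -/

section Step

variable {V : Type*} [Fintype V] [DecidableEq V]

/-- The minimal minimizer of the saturation capacity problem is contained in every minimizer. -/
theorem minimalMinimizer_subset {H : Finset V → ℝ} {α : ℝ}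
    (hg : IntersectingSubmodular (fDual H α)) {r : V → ℝ} {P : Finset (Finset V)}
    (hP : (P : Set (Finset V)).PairwiseDisjoint id) {φ : V} {W : Finset (Finset V)} (hW : W ⊆ P)
    (hmin : satObjective H α r φ W ≤
      satObjective H α r φ (minimalMinimizer (satObjective H α r φ) P)) :
    minimalMinimizer (satObjective H α r φ) P ⊆ W := by
  set U := minimalMinimizer (satObjective H α r φ) P with hU
  have hmm : IsMinimalMinimizer (satObjective H α r φ) P U :=
    (exists_isMinimalMinimizer (satObjective H α r φ) P).choose_spec
  have hUP : U ⊆ P := hmm.prop.1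
  have hX : ({φ} ∪ fuse U) ∪ ({φ} ∪ fuse W) = {φ} ∪ fuse (U ∪ W) := by
    rw [fuse_union, ← union_union_distrib_left]
  have hI : ({φ} ∪ fuse U) ∩ ({φ} ∪ fuse W) = {φ} ∪ fuse (U ∩ W) := by
    rw [fuse_inter hP hUP hW, ← union_inter_distrib_left]
  have h1 := hg ({φ} ∪ fuse U) ({φ} ∪ fuse W) ⟨φ, by simp⟩
  have h2 := sum_union_inter (s₁ := {φ} ∪ fuse U) (s₂ := {φ} ∪ fuse W) (f := r)
  rw [hX, hI] at h1 h2
  have h3 := hmm.prop.2 (U ∪ W) (union_subset hUP hW)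
  -- Minimizers are closed under intersection by submodularity, so minimality of `U` forces `U ⊆ U ∩
  -- W`.
  have h4 : satObjective H α r φ (U ∩ W) ≤ satObjective H α r φ U := by
    unfold satObjective at h3 hmin ⊢
    linarith
  have h5 := hmm.le_of_le (y := U ∩ W)
    ⟨inter_subset_left.trans hUP, fun T hT => h4.trans (hmm.prop.2 T hT)⟩ inter_subset_left
  exact fun B hB => (mem_inter.1 (h5 hB)).2

/-- The blocks are nonempty and disjoint and `φ` is new, so the family of blocks to be merged is
just `U`. -/
theorem satStep_eq (H : Finset V → ℝ) (α : ℝ) {r : V → ℝ} {P : Finset (Finset V)} {φ : V}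
    (hne : ∀ B ∈ P, B.Nonempty) (hP : (P : Set (Finset V)).PairwiseDisjoint id)
    (hφ : φ ∉ fuse P) {U : Finset (Finset V)} (hU : U = minimalMinimizer (satObjective H α r φ) P) :
    satStep H α (r, P) φ =
      (Function.update r φ (r φ + satObjective H α r φ U), (P \ U) ∪ {{φ} ∪ fuse U}) := by
  have hUP : U ⊆ P := by
    rw [hU]
    exact (exists_isMinimalMinimizer (satObjective H α r φ) P).choose_spec.prop.1
  have h1 : fuse (U ∪ {{φ}}) = {φ} ∪ fuse U := by
    rw [fuse_union, union_comm]
    simp [fuse]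
  have h2 : (P.filter fun X => (X ∩ fuse (U ∪ {{φ}})).Nonempty) = U := by
    ext B
    rw [mem_filter, h1]
    constructor
    · rintro ⟨hB, v, hv⟩
      obtain ⟨hvB, hv⟩ := mem_inter.1 hv
      rcases mem_union.1 hv with hv | hv
      · rw [mem_singleton.1 hv] at hvB
        exact absurd (mem_fuse.2 ⟨B, hB, hvB⟩) hφ
      · obtain ⟨C, hC, hvC⟩ := mem_fuse.1 hv
        have : B = C := hP.elim_finset hB (hUP hC) v hvB hvC
        exact this ▸ hC
    · intro hB
      obtain ⟨v, hv⟩ := hne B (hUP hB)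
      exact ⟨hUP hB, v, mem_inter.2 ⟨hv, mem_union_right _ (mem_fuse.2 ⟨B, hB, hv⟩)⟩⟩
  unfold satStep
  simp only [← hU, h2]
  rw [h1, union_assoc, union_self]

theorem IsSaturated.satStep {H : Finset V → ℝ} {α : ℝ} (hg : IntersectingSubmodular (fDual H α))
    {A : Finset V} {s : (V → ℝ) × Finset (Finset V)} {φ : V}
    (h : IsSaturated (fDual H α) A s.1 s.2) (hφ : φ ∉ A) :
    IsSaturated (fDual H α) (insert φ A) (satStep H α s φ).1 (satStep H α s φ).2 := by
  obtain ⟨r, P⟩ := s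
  simp only at h
  set g := fDual H α
  obtain ⟨U, hU⟩ : ∃ U, U = minimalMinimizer (satObjective H α r φ) P := ⟨_, rfl⟩
  have hmm : IsMinimalMinimizer (satObjective H α r φ) P U := by
    rw [hU]
    exact (exists_isMinimalMinimizer (satObjective H α r φ) P).choose_spec
  have hUP : U ⊆ P := hmm.prop.1
  rw [satStep_eq H α h.nonempty h.disjoint (by rwa [h.fuse_eq]) hU]
  simp only
  set ξ := satObjective H α r φ U with hξ
  set r' := Function.update r φ (r φ + ξ) with hr'
  have hsum : ∀ X, φ ∉ X → ∑ i ∈ X, r' i = ∑ i ∈ X, r i := fun X hX =>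
    sum_update_of_notMem hX _ _
  have hsum' : ∀ X, φ ∈ X → ∑ i ∈ X, r' i = ∑ i ∈ X, r i + ξ := fun X hX => by
    rw [hr', sum_update_of_mem hX, ← add_sum_erase X r hX, sdiff_singleton_eq_erase]
    ring
  -- the slack of a set that contains `φ`
  have hslack : ∀ X ⊆ insert φ A, φ ∈ X →
      satObjective H α r φ (P.filter fun B => (X ∩ B).Nonempty) ≤ g X - ∑ i ∈ X, r i := by
    intro X hX hφX
    have := h.slack_union_fuse_le hg X (filter_subset (fun B => (X ∩ B).Nonempty) P)
      fun B hB => (mem_filter.1 hB).2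
    rwa [h.subset_union_fuse_filter hX hφX] at this
  have hle : ∀ X ⊆ insert φ A, X.Nonempty → ∑ i ∈ X, r' i ≤ g X := by
    intro X hX hne
    by_cases hφX : φ ∈ X
    · rw [hsum' X hφX]
      have h1 := hslack X hX hφX
      have h2 := hmm.prop.2 (P.filter fun B => (X ∩ B).Nonempty) (filter_subset _ _)
      linarith
    · rw [hsum X hφX]
      exact h.le X ((subset_insert_iff_of_notMem hφX).1 hX) hne
  have hφB : ∀ B ∈ P, φ ∉ B := fun B hB hv => hφ (h.block_subset hB hv)
  have hdisj : ∀ B ∈ P \ U, Disjoint B ({φ} ∪ fuse U) := by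
    intro B hB
    rw [mem_sdiff] at hB
    rw [disjoint_left]
    intro v hv hv'
    rcases mem_union.1 hv' with hv' | hv'
    · exact hφB B hB.1 (mem_singleton.1 hv' ▸ hv)
    · obtain ⟨C, hC, hvC⟩ := mem_fuse.1 hv'
      have : B = C := h.disjoint.elim_finset hB.1 (hUP hC) v hv hvC
      exact hB.2 (this ▸ hC)
  refine ⟨?_, ?_, ?_, hle, ?_, ?_⟩
  · intro B hB
    rcases mem_union.1 hB with hB | hB
    · exact h.nonempty B (mem_sdiff.1 hB).1
    · rw [mem_singleton.1 hB]
      exact ⟨φ, by simp⟩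
  · intro B hB C hC hne
    rw [mem_coe, mem_union, mem_singleton] at hB hC
    rcases hB with hB | rfl <;> rcases hC with hC | rfl
    · exact h.disjoint (mem_sdiff.1 hB).1 (mem_sdiff.1 hC).1 hne
    · exact hdisj B hB
    · exact (hdisj C hC).symm
    · exact absurd rfl hne
  · rw [fuse_union, ← h.fuse_eq, ← sdiff_union_of_subset hUP, fuse_union, sdiff_union_of_subset hUP]
    ext v
    simp only [mem_union, mem_fuse, mem_sdiff, mem_singleton, mem_insert, exists_eq_left]
    exact or_left_comm
  · intro B hB
    rcases mem_union.1 hB with hB | hB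
    · rw [hsum B (hφB B (mem_sdiff.1 hB).1)]
      exact h.tight B (mem_sdiff.1 hB).1
    · rw [mem_singleton.1 hB, hsum' _ (by simp), hξ, satObjective]
      ring
  · intro c hc
    have hold := h.finest c fun v hv => by
      obtain ⟨W, hWA, hvW, hWt, hWc⟩ := hc v (mem_insert_of_mem hv)
      rw [← h.fuse_eq] at hv
      obtain ⟨B, hB, hvB⟩ := mem_fuse.1 hv
      have hne : (W ∩ B).Nonempty := ⟨v, mem_inter.2 ⟨hvW, hvB⟩⟩
      refine ⟨W ∩ B, inter_subset_right.trans (h.block_subset hB), mem_inter.2 ⟨hvW, hvB⟩, ?_,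
        fun w hw => hWc w (mem_inter.1 hw).1⟩
      have h1 := hg W B hne
      have h2 := hle (W ∪ B)
        (union_subset hWA ((h.block_subset hB).trans (subset_insert _ _))) ⟨v, mem_union_left _ hvW⟩
      have h3 := sum_union_inter (s₁ := W) (s₂ := B) (f := r')
      have h4 := h.tight B hB
      have h5 := h.le (W ∩ B) (inter_subset_right.trans (h.block_subset hB)) hne
      rw [hsum B (hφB B hB), hsum (W ∩ B) fun hw => hφB B hB (mem_inter.1 hw).2] at h3
      linarith
    obtain ⟨W, hWA, hφW, hWt, hWc⟩ := hc φ (mem_insert_self _ _)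
    -- As `W` is tight after the update, its slack before was `ξ`, so the blocks it meets form a
    -- minimizer, which contains `U`. Every merged block therefore meets `W` and takes its colour.
    have hUW : U ⊆ P.filter fun B => (W ∩ B).Nonempty := by
      rw [hU]
      refine minimalMinimizer_subset hg h.disjoint (filter_subset _ _) ?_
      rw [← hU]
      have := hslack W hWA hφW
      rw [hsum' W hφW] at hWt
      linarith
    have hnew : ∀ v ∈ {φ} ∪ fuse U, c v = c φ := by
      intro v hv
      rcases mem_union.1 hv with hv | hv
      · rw [mem_singleton.1 hv]
      · obtain ⟨B, hB, hvB⟩ := mem_fuse.1 hv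
        obtain ⟨hBP, w, hw⟩ := mem_filter.1 (hUW hB)
        rw [mem_inter] at hw
        rw [hold B hBP v hvB w hw.2, hWc w hw.1]
    intro B hB v hv w hw
    rcases mem_union.1 hB with hB | hB
    · exact hold B (mem_sdiff.1 hB).1 v hv w hw
    · rw [mem_singleton] at hB
      subst hB
      rw [hnew v hv, hnew w hw]

theorem isSaturated_foldl {H : Finset V → ℝ} {α : ℝ} (hg : IntersectingSubmodular (fDual H α))
    (l : List V) : ∀ (A : Finset V) (s : (V → ℝ) × Finset (Finset V)),
      IsSaturated (fDual H α) A s.1 s.2 → l.Nodup → (∀ v ∈ l, v ∉ A) →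
      IsSaturated (fDual H α) (A ∪ l.toFinset) (l.foldl (satStep H α) s).1
        (l.foldl (satStep H α) s).2 := by
  induction l with
  | nil => intro A s h _ _; simpa using h
  | cons φ l ih =>
    intro A s h hl hA
    rw [List.nodup_cons] at hl
    have := ih (insert φ A) _ (h.satStep hg (hA φ (by simp))) hl.2 fun v hv hv' => by
      rcases mem_insert.1 hv' with rfl | hv'
      · exact hl.1 hv
      · exact hA v (List.mem_cons_of_mem _ hv) hv'
    rw [List.foldl_cons, List.toFinset_cons, union_insert, ← insert_union]
    exact this

/-- The output of CoordSatCapFus is a vector under the constraints of `f_α^#`, with the finest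
partition into tight sets. -/
theorem isSaturated_coordSatCapFus {H : Finset V → ℝ} {α : ℝ}
    (hg : IntersectingSubmodular (fDual H α)) {l : List V} (hl : l.Nodup) (hne : l ≠ []) :
    IsSaturated (fDual H α) l.toFinset (coordSatCapFus H α l).1 (coordSatCapFus H α l).2 := by
  match l, hne with
  | φ :: l, _ =>
    rw [List.nodup_cons] at hl
    rw [List.toFinset_cons, ← singleton_union]
    refine isSaturated_foldl hg l {φ} _ (isSaturated_singleton (by simp)) hl.2 fun v hv hv' => ?_
    exact hl.1 (mem_singleton.1 hv' ▸ hv)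

end Step

/-! ### The dual function, partition values, and achievability. -/

section Dual

variable {V : Type*} [Fintype V] [DecidableEq V] {H : Finset V → ℝ} {α : ℝ}

/-- At the empty set the dual function is zero instead, which is why submodularity is only claimed
for intersecting pairs. -/
theorem fDual_of_nonempty (H : Finset V → ℝ) (α : ℝ) {X : Finset V} (hX : X.Nonempty) :
    fDual H α X = H X + α - H univ := by
  have h1 : univ \ X ≠ univ := fun h => by
    obtain ⟨v, hv⟩ := hX
    have := h ▸ mem_univ v
    simp [hv] at this
  rw [fDual, fFun, fFun, if_pos rfl, if_neg h1, condEntropy,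
    union_sdiff_of_subset (subset_univ _), Finset.sdiff_sdiff_eq_self (subset_univ X)]
  ring

theorem intersectingSubmodular_fDual
    (hsub : ∀ X Y : Finset V, H (X ∪ Y) + H (X ∩ Y) ≤ H X + H Y) (α : ℝ) :
    IntersectingSubmodular (fDual H α) := by
  intro X Y h
  have hX := h.mono inter_subset_left
  rw [fDual_of_nonempty H α h, fDual_of_nonempty H α hX,
    fDual_of_nonempty H α (h.mono inter_subset_right),
    fDual_of_nonempty H α (hX.mono subset_union_left)]
  linarith [hsub X Y]

theorem partSum_fDual (P : Finpartition (univ : Finset V)) :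
    partSum (fDual H α) P = P.parts.card * α - ∑ X ∈ P.parts, (H univ - H X) := by
  rw [partSum, sum_congr rfl fun X hX => fDual_of_nonempty H α (P.nonempty_of_mem_parts hX),
    ← nsmul_eq_mul, ← sum_const, ← sum_sub_distrib]
  exact sum_congr rfl fun X _ => by ring

theorem one_lt_card_parts [Nonempty V] {P : Finpartition (univ : Finset V)}
    (hP : P.parts ≠ {univ}) : 1 < P.parts.card := by
  have h1 : 0 < P.parts.card := (P.parts_nonempty univ_nonempty.ne_empty).card_pos
  refine lt_of_le_of_ne h1 fun h => hP ?_
  obtain ⟨B, hB⟩ := card_eq_one.1 h.symm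
  have h2 := P.biUnion_parts
  rw [hB, singleton_biUnion, id] at h2
  rw [hB, h2]

theorem card_sub_one_mul_partitionRate [Nonempty V] {P : Finpartition (univ : Finset V)}
    (hP : P.parts ≠ {univ}) :
    ((P.parts.card : ℝ) - 1) * partitionRate H P.parts = ∑ X ∈ P.parts, (H univ - H X) := by
  have h : (1 : ℝ) < P.parts.card := by exact_mod_cast one_lt_card_parts hP
  rw [partitionRate, ← sum_div, mul_div_cancel₀ _ (sub_pos.2 h).ne']

theorem partSum_fDual_of_ne [Nonempty V] {P : Finpartition (univ : Finset V)}
    (hP : P.parts ≠ {univ}) :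
    partSum (fDual H α) P =
      α + ((P.parts.card : ℝ) - 1) * (α - partitionRate H P.parts) := by
  rw [partSum_fDual, ← card_sub_one_mul_partitionRate hP]
  ring

theorem partSum_fDual_of_eq {P : Finpartition (univ : Finset V)} (hP : P.parts = {univ}) :
    partSum (fDual H α) P = α := by
  rw [partSum_fDual, hP]
  simp

/-- The rate of a partition is a lower bound on the achievable sum-rates. -/
theorem partitionRate_le_of_mem_achievableRates [Nonempty V] {r : V → ℝ}
    (hr : r ∈ achievableRates H) {P : Finpartition (univ : Finset V)} (hP : P.parts ≠ {univ}) :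
    partitionRate H P.parts ≤ ∑ i, r i := by
  have h : (1 : ℝ) < P.parts.card := by exact_mod_cast one_lt_card_parts hP
  refine le_of_mul_le_mul_left ?_ (sub_pos.2 h)
  rw [card_sub_one_mul_partitionRate hP]
  -- Add the Slepian-Wolf constraints of the complements of the blocks; each user lies in `|P| - 1`
  -- of these complements.
  calc _ ≤ ∑ X ∈ P.parts, (∑ i, r i - ∑ i ∈ X, r i) := by
        refine sum_le_sum fun X hX => ?_
        obtain ⟨v, hv⟩ := P.nonempty_of_mem_parts hX
        have h1 := hr (univ \ X) (sdiff_ssubset (subset_univ X) ⟨v, hv⟩)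
        rw [condEntropy, union_sdiff_of_subset (subset_univ _),
          Finset.sdiff_sdiff_eq_self (subset_univ X)] at h1
        have h2 := sum_sdiff (f := r) (subset_univ X)
        linarith
    _ = _ := by
        rw [sum_sub_distrib, ← sum_eq_sum_parts P r, sum_const, nsmul_eq_mul]
        ring

/-- With `r(V) = α` fixed, an upper bound on a set is a lower bound on its complement. -/
theorem mem_achievableRates_of_le {r : V → ℝ}
    (hle : ∀ X : Finset V, X.Nonempty → ∑ i ∈ X, r i ≤ fDual H α X) (hr : ∑ i, r i = α) :
    r ∈ achievableRates H := by
  intro X hX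
  have hne : (univ \ X).Nonempty := sdiff_nonempty.2 fun h => hX.2 h
  have h1 := hle _ hne
  rw [fDual_of_nonempty H α hne] at h1
  have h2 := sum_sdiff (f := r) (subset_univ X)
  rw [condEntropy, union_sdiff_of_subset (subset_univ X)]
  linarith

end Dual

/-! ### Finest minimizers and their monotonicity in the estimate. -/

namespace IsSaturated

variable {V : Type*} [Fintype V] [DecidableEq V] {g : Finset V → ℝ} {r : V → ℝ}

theorem exists_finpartition {P : Finset (Finset V)} (h : IsSaturated g univ r P) :
    ∃ Q : Finpartition (univ : Finset V), Q.parts = P :=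
  ⟨{ parts := P
     supIndep := supIndep_iff_pairwiseDisjoint.2 h.disjoint
     sup_parts := by rw [sup_eq_biUnion]; exact h.fuse_eq
     bot_notMem := fun hb => (h.nonempty _ hb).ne_empty rfl }, rfl⟩

variable {P : Finpartition (univ : Finset V)}

theorem sum_eq_partSum (h : IsSaturated g univ r P.parts) : ∑ i, r i = partSum g P := by
  rw [sum_eq_sum_parts P r, partSum]
  exact sum_congr rfl h.tight

theorem sum_le_partSum {P : Finset (Finset V)} (h : IsSaturated g univ r P) {X : Finset V}
    (Q : Finpartition X) : ∑ i ∈ X, r i ≤ partSum g Q := by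
  rw [sum_eq_sum_parts Q r, partSum]
  exact sum_le_sum fun B hB => h.le B (subset_univ B) (Q.nonempty_of_mem_parts hB)

theorem isFinestMinimizer (h : IsSaturated g univ r P.parts) : IsFinestMinimizer g P := by
  refine ⟨fun Q => h.sum_eq_partSum ▸ h.sum_le_partSum Q, fun Q hQ => ?_⟩
  have hsum : ∑ B ∈ Q.parts, ∑ i ∈ B, r i = ∑ B ∈ Q.parts, g B := by
    rw [← sum_eq_sum_parts Q r]
    exact le_antisymm (h.sum_le_partSum Q) (h.sum_eq_partSum ▸ hQ P)
  have htight := (sum_eq_sum_iff_of_le fun B hB =>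
    h.le B (subset_univ B) (Q.nonempty_of_mem_parts hB)).1 hsum
  intro B hB
  obtain ⟨v, hv⟩ := h.nonempty B hB
  refine ⟨Q.part v, Q.part_mem.2 (mem_univ v), fun w hw => ?_⟩
  -- Colour each user by its block in `Q`: these blocks are tight and monochromatic, so each block
  -- of `P` lies inside one of them.
  have hc := h.finest Q.part (fun u _ => ⟨Q.part u, subset_univ _, Q.mem_part (mem_univ u),
    htight _ (Q.part_mem.2 (mem_univ u)), fun x hx =>
      Q.part_eq_of_mem (Q.part_mem.2 (mem_univ u)) hx⟩) B hB v hv w hw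
  rw [hc]
  exact Q.mem_part (mem_univ w)

theorem mem_basePolyhedron (h : IsSaturated g univ r P.parts) :
    r ∈ basePolyhedron (dilworthTruncation g) := by
  have hle : ∀ X : Finset V, ∑ i ∈ X, r i ≤ dilworthTruncation g X := fun X =>
    le_ciInf fun Q => h.sum_le_partSum Q
  refine ⟨hle, le_antisymm (hle _) ?_⟩
  rw [h.sum_eq_partSum]
  exact ciInf_le (Set.finite_range _).bddBelow P

/-- The finest minimizers become coarser when the estimate increases. -/
theorem le_of_lt {H : Finset V → ℝ} (hsub : ∀ X Y : Finset V, H (X ∪ Y) + H (X ∩ Y) ≤ H X + H Y)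
    {α α' : ℝ} (hα : α < α') {r' : V → ℝ} {Q : Finpartition (univ : Finset V)}
    (hP : IsSaturated (fDual H α) univ r P.parts)
    (hQ : IsSaturated (fDual H α') univ r' Q.parts) : P ≤ Q := by
  intro B hB
  have hBne := hP.nonempty B hB
  set T := Q.parts.filter fun C => (B ∩ C).Nonempty with hT
  have hTQ : T ⊆ Q.parts := filter_subset _ _
  have hTdisj : (T : Set (Finset V)).PairwiseDisjoint id := hQ.disjoint.subset hTQ
  have hBT : B ⊆ fuse T := by
    intro v hv
    obtain ⟨C, hC, hvC⟩ := Q.exists_mem (mem_univ v)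
    exact mem_fuse.2 ⟨C, mem_filter.2 ⟨hC, v, mem_inter.2 ⟨hv, hvC⟩⟩, hvC⟩
  -- Uncross `B` with the blocks of `Q` that it meets, one at a time.
  have hsubT : ∀ T' ⊆ T, H (B ∪ fuse T') + ∑ C ∈ T', H (B ∩ C) ≤ H B + ∑ C ∈ T', H C := by
    intro T'
    induction T' using Finset.induction_on with
    | empty => simp [fuse]
    | insert C T' hCT' ih =>
      intro hsubset
      have ih := ih ((subset_insert _ _).trans hsubset)
      have hdisj : Disjoint (fuse T') C := by
        rw [disjoint_left]
        intro v hv hvC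
        obtain ⟨D, hD, hvD⟩ := mem_fuse.1 hv
        have : D = C := hTdisj.elim_finset (hsubset (mem_insert_of_mem hD))
          (hsubset (mem_insert_self _ _)) v hvD hvC
        exact hCT' (this ▸ hD)
      have h1 := hsub (B ∪ fuse T') C
      rw [union_inter_distrib_right, disjoint_iff_inter_eq_empty.1 hdisj, union_empty] at h1
      rw [sum_insert hCT', sum_insert hCT', fuse_insert, union_comm C, ← union_assoc]
      linarith
  have key := hsubT T subset_rfl
  rw [union_eq_right.2 hBT] at key
  have h1 : ∑ i ∈ B, r i = H B + α - H univ := by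
    rw [hP.tight B hB, fDual_of_nonempty H α hBne]
  have h2 : ∑ i ∈ fuse T, r' i ≤ H (fuse T) + α' - H univ := by
    rw [← fDual_of_nonempty H α' (hBne.mono hBT)]
    exact hQ.le _ (subset_univ _) (hBne.mono hBT)
  have h3 : ∑ i ∈ fuse T, r' i = ∑ C ∈ T, (H C + α' - H univ) := by
    rw [fuse, sum_biUnion hTdisj]
    refine sum_congr rfl fun C hC => ?_
    rw [id, hQ.tight C (hTQ hC), fDual_of_nonempty H α' (hQ.nonempty C (hTQ hC))]
  have h4 : ∑ i ∈ B, r i ≤ ∑ C ∈ T, (H (B ∩ C) + α - H univ) := by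
    have : B = T.biUnion fun C => B ∩ C := by
      rw [← inter_biUnion]
      exact (inter_eq_left.2 hBT).symm
    conv_lhs => rw [this]
    have hdisj : (T : Set (Finset V)).PairwiseDisjoint fun C => B ∩ C := fun C hC D hD hne =>
      (hTdisj hC hD hne).mono inter_subset_right inter_subset_right
    rw [sum_biUnion hdisj]
    refine sum_le_sum fun C hC => ?_
    have hne := (mem_filter.1 hC).2
    rw [← fDual_of_nonempty H α hne]
    exact hP.le _ (subset_univ _) hne
  simp only [sum_sub_distrib, sum_add_distrib, sum_const, nsmul_eq_mul] at h3 h4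
  -- Tightness of `B` at `α` and of the blocks in `T` at `α'` bounds the uncrossing inequality from
  -- the other side, with a gain of `(|T| - 1)(α' - α)`. So `B` meets only one block of `Q`.
  have hcard : (T.card : ℝ) * (α' - α) ≤ 1 * (α' - α) := by linarith
  have hcard : T.card ≤ 1 := by exact_mod_cast le_of_mul_le_mul_right hcard (sub_pos.2 hα)
  obtain ⟨v, hv⟩ := hBne
  obtain ⟨C, hC, hvC⟩ := mem_fuse.1 (hBT hv)
  refine ⟨C, hTQ hC, fun w hw => ?_⟩
  obtain ⟨D, hD, hwD⟩ := mem_fuse.1 (hBT hw)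
  rwa [card_le_one.1 hcard C hC D hD]

end IsSaturated

/-! ### Termination and correctness of the Modified Decomposition Algorithm. -/

section MDA

variable {V : Type*} [Fintype V] [DecidableEq V] {H : Finset V → ℝ}
  {Φ : Fin (Fintype.card V) ≃ V}

theorem mdaState_α (n : ℕ) :
    (mdaState H Φ n).α = partitionRate H (mdaState H Φ n).P := by
  cases n <;> rfl

theorem isSaturated_mdaState [Nonempty V]
    (hsub : ∀ X Y : Finset V, H (X ∪ Y) + H (X ∩ Y) ≤ H X + H Y) (n : ℕ) :
    IsSaturated (fDual H (mdaState H Φ n).α) univ (mdaState H Φ n).r (mdaState H Φ n).Pstar := by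
  have hl : (List.ofFn Φ).Nodup := List.nodup_ofFn.2 Φ.injective
  have hne : List.ofFn Φ ≠ [] := by simp [Fintype.card_ne_zero]
  have huniv : (List.ofFn Φ).toFinset = univ := by
    ext v
    simp only [List.mem_toFinset, mem_univ, iff_true]
    exact (List.mem_ofFn' _ _).2 (Φ.surjective v)
  have h := fun α => isSaturated_coordSatCapFus (intersectingSubmodular_fDual hsub α) hl hne
  rw [huniv] at h
  cases n <;> exact h _

/-- The current partition of the algorithm is not the trivial one, and it refines the next one. -/
def IsProperRefinement (H : Finset V → ℝ) (Φ : Fin (Fintype.card V) ≃ V) (n : ℕ) : Prop :=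
  ∃ Q : Finpartition (univ : Finset V), Q.parts = (mdaState H Φ n).P ∧ Q.parts ≠ {univ} ∧
    ∀ R : Finpartition (univ : Finset V), R.parts = (mdaState H Φ n).Pstar → Q ≤ R

theorem isProperRefinement_zero (hV : 1 < Fintype.card V) : IsProperRefinement H Φ 0 := by
  refine ⟨⊥, ?_, fun h => ?_, fun R _ => bot_le⟩
  · rw [Finpartition.parts_bot, map_eq_image]
    rfl
  · have := congrArg Finset.card h
    rw [Finpartition.card_bot, card_singleton, card_univ] at this
    omega

theorem IsProperRefinement.succ [Nonempty V]
    (hsub : ∀ X Y : Finset V, H (X ∪ Y) + H (X ∩ Y) ≤ H X + H Y) {n : ℕ}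
    (h : IsProperRefinement H Φ n) (hne : (mdaState H Φ n).Pstar ≠ (mdaState H Φ n).P) :
    (mdaState H Φ n).α < (mdaState H Φ (n + 1)).α ∧ IsProperRefinement H Φ (n + 1) := by
  obtain ⟨Q, hQ, hQne, hQle⟩ := h
  have hsat := isSaturated_mdaState (Φ := Φ) hsub n
  obtain ⟨R, hR⟩ := hsat.exists_finpartition
  have hα : (mdaState H Φ n).α = partitionRate H Q.parts := by rw [mdaState_α, hQ]
  have hα' : (mdaState H Φ (n + 1)).α = partitionRate H R.parts := by rw [mdaState_α, hR]; rfl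
  rw [← hR] at hsat
  have hQsum : partSum (fDual H (mdaState H Φ n).α) Q = (mdaState H Φ n).α := by
    rw [partSum_fDual_of_ne hQne, hα]
    ring
  -- Otherwise `Q`, of value `α`, is a minimizer, so the finest minimizer `R` refines it; the
  -- invariant `Q ≤ R` then gives `R = Q`, and the loop would have stopped.
  have hlt : partSum (fDual H (mdaState H Φ n).α) R < (mdaState H Φ n).α := by
    by_contra! hle
    have hRQ : R ≤ Q := hsat.isFinestMinimizer.2 fun S =>
      hQsum.trans_le <| hle.trans (hsat.isFinestMinimizer.1 S)
    exact hne (by rw [← hQ, ← hR, le_antisymm hRQ (hQle R hR)])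
  have hRne : R.parts ≠ {univ} := fun hR1 => hlt.ne (partSum_fDual_of_eq hR1)
  have hlt' : (mdaState H Φ n).α < (mdaState H Φ (n + 1)).α := by
    have hcard : (1 : ℝ) < R.parts.card := by exact_mod_cast one_lt_card_parts hRne
    rw [partSum_fDual_of_ne hRne, ← hα'] at hlt
    nlinarith
  refine ⟨hlt', R, hR, hRne, fun S hS => ?_⟩
  have hsat' := isSaturated_mdaState (Φ := Φ) hsub (n + 1)
  rw [← hS] at hsat'
  exact hsat.le_of_lt hsub hlt' hsat'

theorem isProperRefinement_of_forall_ne (hV : 1 < Fintype.card V)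
    (hsub : ∀ X Y : Finset V, H (X ∪ Y) + H (X ∩ Y) ≤ H X + H Y) :
    ∀ n : ℕ, (∀ m < n, (mdaState H Φ m).Pstar ≠ (mdaState H Φ m).P) → IsProperRefinement H Φ n := by
  have : Nonempty V := Fintype.card_pos_iff.1 (by omega)
  intro n
  induction n with
  | zero => exact fun _ => isProperRefinement_zero hV
  | succ n ih =>
    exact fun h => ((ih fun m hm => h m (by omega)).succ hsub (h n (by omega))).2

/-- The estimate is a function of the current partition, so strictly increasing estimates never
repeat one of the finitely many partitions. -/
theorem exists_mdaStopsAfter (hV : 1 < Fintype.card V)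
    (hsub : ∀ X Y : Finset V, H (X ∪ Y) + H (X ∩ Y) ≤ H X + H Y) :
    ∃ N, MDAStopsAfter H Φ N := by
  classical
  have : Nonempty V := Fintype.card_pos_iff.1 (by omega)
  have hex : ∃ n, (mdaState H Φ n).Pstar = (mdaState H Φ n).P := by
    by_contra! hne
    have hmono : StrictMono fun n => (mdaState H Φ n).α := strictMono_nat_of_lt_succ fun n =>
      ((isProperRefinement_of_forall_ne hV hsub n fun m _ => hne m).succ hsub (hne n)).1
    refine not_injective_infinite_finite (fun n => (mdaState H Φ n).P) fun m n hmn => ?_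
    refine hmono.injective ?_
    simp only [mdaState_α] at hmn ⊢
    rw [hmn]
  exact ⟨Nat.find hex, fun n hn => Nat.find_min hex hn, Nat.find_spec hex⟩

/-- The Modified Decomposition Algorithm is correct for submodular functions. -/
theorem mda_correct (hV : 1 < Fintype.card V)
    (hsub : ∀ X Y : Finset V, H (X ∪ Y) + H (X ∩ Y) ≤ H X + H Y) :
    IsLeast (achievableSumRates H) (RACO H) ∧
    ∃ N : ℕ, MDAStopsAfter H Φ N ∧
      (mdaState H Φ N).α = RACO H ∧
      (∃ P : Finpartition (univ : Finset V), P.parts = (mdaState H Φ N).Pstar ∧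
        IsFundamentalPartition H P ∧ partitionRate H P.parts = RACO H) ∧
      (mdaState H Φ N).r ∈ optimalRates H ∧
      (∀ n ≤ N,
        (∃ P : Finpartition (univ : Finset V), P.parts = (mdaState H Φ n).Pstar ∧
          IsFinestMinimizer (fDual H (mdaState H Φ n).α) P) ∧
        (mdaState H Φ n).r ∈ basePolyhedron
          (dilworthTruncation (fDual H (mdaState H Φ n).α))) ∧
      StrictMonoOn (fun n => (mdaState H Φ n).α) (Set.Iic N) := by
  have : Nonempty V := Fintype.card_pos_iff.1 (by omega)
  obtain ⟨N, hN⟩ := exists_mdaStopsAfter (Φ := Φ) hV hsub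
  obtain ⟨P, hP, hPne, -⟩ := isProperRefinement_of_forall_ne hV hsub N hN.1
  have hPstar : P.parts = (mdaState H Φ N).Pstar := hP.trans hN.2.symm
  have hsat := isSaturated_mdaState (Φ := Φ) hsub N
  rw [← hPstar] at hsat
  have hα : (mdaState H Φ N).α = partitionRate H P.parts := by rw [mdaState_α, hP]
  have hPsum : partSum (fDual H (mdaState H Φ N).α) P = (mdaState H Φ N).α := by
    rw [partSum_fDual_of_ne hPne, hα]
    ring
  have hrsum : ∑ i, (mdaState H Φ N).r i = (mdaState H Φ N).α := hsat.sum_eq_partSum.trans hPsum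
  have hr : (mdaState H Φ N).r ∈ achievableRates H :=
    mem_achievableRates_of_le (fun X hX => hsat.le X (subset_univ X) hX) hrsum
  have hleast : IsLeast (achievableSumRates H) (mdaState H Φ N).α := by
    refine ⟨⟨_, hr, hrsum⟩, ?_⟩
    rintro _ ⟨r, hr, rfl⟩
    rw [hα]
    exact partitionRate_le_of_mem_achievableRates hr hPne
  have hRACO : RACO H = (mdaState H Φ N).α := hleast.csInf_eq
  refine ⟨hRACO ▸ hleast, N, hN, hRACO.symm, ⟨P, hPstar, ⟨⟨hPne, fun Q hQ => ?_⟩, fun Q hQ => ?_⟩,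
    by rw [hRACO, hα]⟩, ⟨hr, hrsum.trans hRACO.symm⟩, fun n _ => ?_, ?_⟩
  · rw [← hα, ← hrsum]
    exact partitionRate_le_of_mem_achievableRates hr hQ
  -- Any maximizer `Q` of the rate has `ρ(Q) = α`, hence value `α` as well; it is a minimizer of
  -- `f^#_α` and is refined by `P`.
  · refine hsat.isFinestMinimizer.2 fun R => le_trans ?_ (hsat.isFinestMinimizer.1 R)
    have h1 : partitionRate H Q.parts = partitionRate H P.parts :=
      le_antisymm (by
        rw [← hα, ← hrsum]
        exact partitionRate_le_of_mem_achievableRates hr hQ.1) (hQ.2 P hPne)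
    rw [hPsum, partSum_fDual_of_ne hQ.1, h1, ← hα]
    simp
  · have hsatn := isSaturated_mdaState (Φ := Φ) hsub n
    obtain ⟨R, hR⟩ := hsatn.exists_finpartition
    rw [← hR] at hsatn
    exact ⟨⟨R, hR, hsatn.isFinestMinimizer⟩, hsatn.mem_basePolyhedron⟩
  · refine strictMonoOn_of_lt_add_one Set.ordConnected_Iic fun n _ _ hn => ?_
    have hn : n < N := hn
    exact ((isProperRefinement_of_forall_ne hV hsub n fun m hm => hN.1 m (hm.trans hn)).succ hsub
      (hN.1 n hn)).1

end MDA

end Omniscience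

theorem theorem1 {V : Type*} [Fintype V] [DecidableEq V] (hV : 1 < Fintype.card V)
    {Ω : Type*} [MeasurableSpace Ω] (μ : Measure Ω) [IsProbabilityMeasure μ]
    {S : V → Type*} [∀ i, MeasurableSpace (S i)] [∀ i, MeasurableSingletonClass (S i)]
    [∀ i, Countable (S i)] (Z : ∀ i, Ω → S i) (hZ : ∀ i, Measurable (Z i))
    (b : ℝ) (hb : 1 < b)
    (hfin : Summable (Omniscience.entropyTerm b μ Z (univ : Finset V)))
    (H : Finset V → ℝ) (hH : H = Omniscience.entropy b μ Z)
    (Φ : Fin (Fintype.card V) ≃ V) :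
    IsLeast (Omniscience.achievableSumRates H) (Omniscience.RACO H) ∧
    ∃ N : ℕ, Omniscience.MDAStopsAfter H Φ N ∧
      -- the returned values
      (Omniscience.mdaState H Φ N).α = Omniscience.RACO H ∧
      (∃ P : Finpartition (univ : Finset V), P.parts = (Omniscience.mdaState H Φ N).Pstar ∧
        Omniscience.IsFundamentalPartition H P ∧
        Omniscience.partitionRate H P.parts = Omniscience.RACO H) ∧
      (Omniscience.mdaState H Φ N).r ∈ Omniscience.optimalRates H ∧
      -- each call of CoordSatCapFus solves the Dilworth truncation problem
      (∀ n ≤ N,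
        (∃ P : Finpartition (univ : Finset V), P.parts = (Omniscience.mdaState H Φ n).Pstar ∧
          Omniscience.IsFinestMinimizer
            (Omniscience.fDual H (Omniscience.mdaState H Φ n).α) P) ∧
        (Omniscience.mdaState H Φ n).r ∈ Omniscience.basePolyhedron
          (Omniscience.dilworthTruncation
            (Omniscience.fDual H (Omniscience.mdaState H Φ n).α))) ∧
      -- the estimates increase up to the minimum sum-rate
      StrictMonoOn (fun n => (Omniscience.mdaState H Φ n).α) (Set.Iic N) := by
  subst hH
  exact Omniscience.mda_correct hV (Omniscience.entropy_submodular hZ hb hfin)
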